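/- Let $\{X_{i,j}: i,j\in\mathbb{N}\}$ be independent centered Gaussian processes indexed by $\mathbb{R}_+=[0,\infty)$, defined on a probability space $(\Omega,\mathcal F,\mathbb P)$, with common covariance function $R(s,t)=\mathbb{E}[X_{i,j}(s)X_{i,j}(t)]$. Assume **(H2)** there exist constants $\kappa,\gamma>0$ such that $R(s,s)-2R(s,t)+R(t,t)\le\kappa|t-s|^{\gamma}$ for all $s,t>0$. For each $n\ge 1$ let $A^{(n)}$ be a deterministic real symmetric $n\times n$ matrix, and assume that the empirical spectral measures $\frac1n\sum_{j=1}^n\delta_{\lambda_j(A^{(n)})}$ converge weakly, as $n\to\infty$, to a probability measure $\mu_0$ on $\mathbb{R}$. Let $Y^{(n)}(t)$ be the symmetric $n\times n$ matrix with entries $Y^{(n)}_{i,j}(t)=\frac{1}{\sqrt n}X_{i,j}(t)+A^{(n)}_{i,j}$ for $i<j$ and $Y^{(n)}_{i,i}(t)=\frac{\sqrt2}{\sqrt n}X_{i,i}(t)+A^{(n)}_{i,i}$, let $\lambda^{(n)}_1(t)\ge\dots\ge\lambda^{(n)}_n(t)$ be its eigenvalues, and let $\mu^{(n)}_t=\frac1n\sum_{j=1}^n\delta_{\lambda^{(n)}_j(t)}$.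 Let $\mathrm{Pr}(\mathbb{R})$ be the space of Borel probability measures on $\mathbb{R}$ with the weak topology, and let $\mathcal C(\mathbb{R}_+,\mathrm{Pr}(\mathbb{R}))$ carry the topology of uniform convergence on compact intervals and its Borel $\sigma$-algebra. Then the sequence of laws of the empirical spectral measure processes $\mu^{(n)}=(\mu^{(n)}_t)_{t\ge0}$, $n\ge1$, is tight in $\mathcal C(\mathbb{R}_+,\mathrm{Pr}(\mathbb{R}))$. More precisely: 1. If every $X_{i,j}$ has almost surely continuous paths, then for each $n$ there is a random element $M^{(n)}$ of $\mathcal C(\mathbb{R}_+,\mathrm{Pr}(\mathbb{R}))$ such that, almost surely, $M^{(n)}_t=\mu^{(n)}_t$ for all $t\ge0$. 2. Whenever $M^{(n)}$, $n\ge1$, are random elements of $\mathcal C(\mathbb{R}_+,\mathrm{Pr}(\mathbb{R}))$ with $M^{(n)}_t=\mu^{(n)}_t$ almost surely for each $t\ge0$ and $n\ge1$, the family of laws of $M^{(n)}$, $n\ge1$, is tight: for every $\varepsilon>0$ there is a compact set $K\subset\mathcal C(\mathbb{R}_+,\mathrm{Pr}(\mathbb{R}))$ with $\mathbb{P}(M^{(n)}\notin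 K)\le\varepsilon$ for all $n\ge1$. -/

import Mathlib

open MeasureTheory ProbabilityTheory Filter
open scoped NNReal ENNReal Topology

namespace SpectralTightness

/-- The empirical spectral measure `(1/n) ∑ⱼ δ_{λⱼ}` of a real symmetric `n × n` matrix with
eigenvalues `λ₁, …, λₙ` (repeated according to multiplicity), for `n ≥ 1`. -/
noncomputable def empiricalSpectralMeasure {n : ℕ} [NeZero n] {A : Matrix (Fin n) (Fin n) ℝ}
    (hA : A.IsHermitian) : ProbabilityMeasure ℝ :=
  ⟨(n : ℝ≥0∞)⁻¹ • ∑ j, Measure.dirac (hA.eigenvalues j), ⟨by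
    simp [ENNReal.inv_mul_cancel (Nat.cast_ne_zero.2 (NeZero.ne n)) (ENNReal.natCast_ne_top n)]⟩⟩

/-- The symmetric matrix built from an array `x` of real numbers (of which only the entries on and
above the diagonal are used) and a symmetric matrix `A`: its entry at `i < j` is
`x i j / √n + A i j`, its entry at `i = j` is `√2 / √n * x i i + A i i`, and the entries below the
diagonal are determined by symmetry. -/
noncomputable def renormalizedMatrix {n : ℕ} (x : ℕ → ℕ → ℝ) (A : Matrix (Fin n) (Fin n) ℝ) :
    Matrix (Fin n) (Fin n) ℝ :=
  Matrix.of fun i j =>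
    if i < j then 1 / √(n : ℝ) * x i j + A i j
    else if i = j then √2 / √(n : ℝ) * x i i + A i i
    else 1 / √(n : ℝ) * x j i + A j i

theorem renormalizedMatrix_isHermitian {n : ℕ} (x : ℕ → ℕ → ℝ) (A : Matrix (Fin n) (Fin n) ℝ) :
    (renormalizedMatrix x A).IsHermitian := by
  ext i j
  simp only [Matrix.conjTranspose_apply, renormalizedMatrix, Matrix.of_apply, star_trivial]
  rcases lt_trichotomy i j with h | h | h
  · simp [h, h.not_gt, h.ne']
  · simp [h]
  · simp [h, h.not_gt, h.ne']

/-- The empirical spectral measure, at time `t` and outcome `ω`, of the renormalized symmetric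
matrix-valued process built from the processes `X i j` and the deterministic matrix `A`. -/
noncomputable def spectralProcess {Ω : Type*} (X : ℕ → ℕ → ℝ≥0 → Ω → ℝ) {n : ℕ} [NeZero n]
    (A : Matrix (Fin n) (Fin n) ℝ) (t : ℝ≥0) (ω : Ω) : ProbabilityMeasure ℝ :=
  empiricalSpectralMeasure (renormalizedMatrix_isHermitian (fun i j => X i j t ω) A)

/-- The increment condition on a covariance function: for some `κ, γ > 0`,
`R(s,s) - 2 R(s,t) + R(t,t) ≤ κ |t - s| ^ γ` for all `s, t > 0`. -/
def IncrementCondition (R : ℝ≥0 → ℝ≥0 → ℝ) : Prop :=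
  ∃ κ γ : ℝ, 0 < κ ∧ 0 < γ ∧ ∀ s t : ℝ≥0, 0 < s → 0 < t →
    R s s - 2 * R s t + R t t ≤ κ * |(t : ℝ) - (s : ℝ)| ^ γ

/-- `C(ℝ≥0, ProbabilityMeasure ℝ)` carries the compact-open topology, that is, the topology of
uniform convergence on compact sets for (any uniformity inducing) the weak topology; it is given
its Borel σ-algebra. -/
noncomputable instance instMeasurableSpacePathSpace : MeasurableSpace C(ℝ≥0, ProbabilityMeasure ℝ) := borel _

instance instBorelSpacePathSpace : BorelSpace C(ℝ≥0, ProbabilityMeasure ℝ) := ⟨rfl⟩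

end SpectralTightness

/-!
The empirical spectral measures are compared in the Lévy–Prokhorov metric, through a coupling of
two spectra. If `uᵢ` and `vⱼ` are orthonormal eigenbases of symmetric matrices `A` and `B`, then
the numbers `⟪uᵢ, vⱼ⟫ ^ 2` form a doubly stochastic matrix, and the quadratic cost of the coupling of
the eigenvalues that it defines is exactly the squared Frobenius norm of `A - B`
(`sum_overlap_sq_mul_sub_sq`). With `V = ‖A - B‖² / n`, Markov's inequality for this coupling bounds
the mass of a set by the mass of its `δ`-thickening plus `V / δ ^ 2`
(`empiricalSpectralMeasure_real_le`), so that the Lévy–Prokhorov distance is at most `δ` as soon as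
`V ≤ δ ^ 3`. In particular the empirical spectral measure depends continuously on the matrix, which,
together with the description of the Borel σ-algebra of a path space by evaluations
(`measurable_of_measurable_eval`), gives the random elements of the path space.

For tightness, `V` at two times `s, t` is at most twice the mean of the squared increments of the
`n²` entries (counted by position). By Jensen's inequality and the formula for even Gaussian
moments, its `m`-th moment is at most a constant times `|t - s| ^ (γ m)`, uniformly in `n`. Taking `m`
large makes a Kolmogorov criterion applicable (`isTightMeasureSet_of_dyadic`): the increments over
consecutive dyadic points are all small with high probability, chaining turns this into a modulus of
continuity, and the Arzelà–Ascoli theorem applies because the Lévy–Prokhorov metric is complete. The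
increments are used at positive times only, and the modulus extends to time `0` by continuity of the
paths. At a fixed time, the spectral measure is at bounded quadratic cost from that of the
deterministic matrix with high probability, and the latter form a tight family since they converge
(`exists_isCompact_spectralProcess`).
-/

namespace SpectralTightness

/-! ### Comparison of empirical spectral measures -/

section Spectral

variable {n : ℕ} {A B : Matrix (Fin n) (Fin n) ℝ}

/-- The orthogonal matrix of inner products `⟪uᵢ, vⱼ⟫` between the eigenvectors `uᵢ` of `A` and `vⱼ`
of `B`. The squares of its entries form a doubly stochastic matrix, which couples the spectra of
`A` and `B`. -/
noncomputable def overlap (hA : A.IsHermitian) (hB : B.IsHermitian) : Matrix (Fin n) (Fin n) ℝ :=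
  (hA.eigenvectorUnitary : Matrix (Fin n) (Fin n) ℝ).transpose * hB.eigenvectorUnitary

lemma overlap_mul_transpose (hA : A.IsHermitian) (hB : B.IsHermitian) :
    overlap hA hB * (overlap hA hB).transpose = 1 := by
  have h1 : (hA.eigenvectorUnitary : Matrix (Fin n) (Fin n) ℝ).transpose *
      hA.eigenvectorUnitary = 1 := Unitary.coe_star_mul_self hA.eigenvectorUnitary
  have h2 : (hB.eigenvectorUnitary : Matrix (Fin n) (Fin n) ℝ) *
      (hB.eigenvectorUnitary : Matrix (Fin n) (Fin n) ℝ).transpose = 1 :=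
    Unitary.coe_mul_star_self hB.eigenvectorUnitary
  rw [overlap, Matrix.transpose_mul, Matrix.transpose_transpose, Matrix.mul_assoc,
    ← Matrix.mul_assoc _ _ (hA.eigenvectorUnitary : Matrix (Fin n) (Fin n) ℝ), h2,
    Matrix.one_mul, h1]

lemma transpose_overlap_mul (hA : A.IsHermitian) (hB : B.IsHermitian) :
    (overlap hA hB).transpose * overlap hA hB = 1 :=
  mul_eq_one_comm.1 (overlap_mul_transpose hA hB)

lemma sum_overlap_sq_right (hA : A.IsHermitian) (hB : B.IsHermitian) (i : Fin n) :
    ∑ j, overlap hA hB i j ^ 2 = 1 := by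
  have h := congrFun (congrFun (overlap_mul_transpose hA hB) i) i
  simpa [Matrix.mul_apply, sq] using h

lemma sum_overlap_sq_left (hA : A.IsHermitian) (hB : B.IsHermitian) (j : Fin n) :
    ∑ i, overlap hA hB i j ^ 2 = 1 := by
  have h := congrFun (congrFun (transpose_overlap_mul hA hB) j) j
  simpa [Matrix.mul_apply, sq] using h

lemma sum_sq_eq_trace (M : Matrix (Fin n) (Fin n) ℝ) :
    ∑ i, ∑ j, M i j ^ 2 = (M.transpose * M).trace := by
  rw [Finset.sum_comm]
  simp [Matrix.trace, Matrix.mul_apply, sq]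

/-- The coupling of the spectra of `A` and `B` given by the squared overlaps has quadratic cost
exactly `‖A - B‖²` in the Frobenius norm. This replaces the Hoffman–Wielandt inequality, and needs
no ordering of the eigenvalues. -/
lemma sum_overlap_sq_mul_sub_sq (hA : A.IsHermitian) (hB : B.IsHermitian) :
    ∑ i, ∑ j, overlap hA hB i j ^ 2 * (hA.eigenvalues i - hB.eigenvalues j) ^ 2 =
      ∑ i, ∑ j, (A i j - B i j) ^ 2 := by
  set U : Matrix (Fin n) (Fin n) ℝ := hA.eigenvectorUnitary.1 with hU
  set V : Matrix (Fin n) (Fin n) ℝ := hB.eigenvectorUnitary.1 with hV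
  have hUU : U.transpose * U = 1 := Unitary.coe_star_mul_self hA.eigenvectorUnitary
  have hVV : V.transpose * V = 1 := Unitary.coe_star_mul_self hB.eigenvectorUnitary
  have hUU' : U * U.transpose = 1 := mul_eq_one_comm.1 hUU
  have hVV' : V * V.transpose = 1 := mul_eq_one_comm.1 hVV
  have hAs : A = U * Matrix.diagonal hA.eigenvalues * U.transpose := by
    have := hA.spectral_theorem
    rw [Unitary.conjStarAlgAut_apply] at this
    exact this
  have hBs : B = V * Matrix.diagonal hB.eigenvalues * V.transpose := by
    have := hB.spectral_theorem
    rw [Unitary.conjStarAlgAut_apply] at this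
    exact this
  have hM : U.transpose * (A - B) * V =
      Matrix.diagonal hA.eigenvalues * overlap hA hB -
        overlap hA hB * Matrix.diagonal hB.eigenvalues := by
    have h1 : U.transpose * A = Matrix.diagonal hA.eigenvalues * U.transpose := by
      conv_lhs => rw [hAs]
      rw [← Matrix.mul_assoc, ← Matrix.mul_assoc, hUU, Matrix.one_mul]
    have h2 : B * V = V * Matrix.diagonal hB.eigenvalues := by
      conv_lhs => rw [hBs]
      rw [Matrix.mul_assoc, hVV, Matrix.mul_one]
    rw [Matrix.mul_sub, Matrix.sub_mul, h1, Matrix.mul_assoc U.transpose B V, h2, overlap]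
    simp only [Matrix.mul_assoc, hU, hV]
  calc _ = ∑ i, ∑ j, (U.transpose * (A - B) * V) i j ^ 2 := by
        rw [hM]
        refine Finset.sum_congr rfl fun i _ => Finset.sum_congr rfl fun j _ => ?_
        rw [Matrix.sub_apply, Matrix.diagonal_mul, Matrix.mul_diagonal]
        ring
    _ = ∑ i, ∑ j, (A - B) i j ^ 2 := by
        rw [sum_sq_eq_trace, sum_sq_eq_trace, Matrix.transpose_mul, Matrix.trace_mul_comm,
          Matrix.transpose_mul, Matrix.transpose_transpose]
        rw [show U.transpose * (A - B) * V * (V.transpose * ((A - B).transpose * U)) =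
          U.transpose * ((A - B) * (V * V.transpose) * (A - B).transpose * U) by
            simp only [Matrix.mul_assoc], hVV', Matrix.mul_one, Matrix.trace_mul_comm,
          Matrix.mul_assoc, hUU', Matrix.mul_one, Matrix.trace_mul_comm]

lemma empiricalSpectralMeasure_real [NeZero n] (hA : A.IsHermitian) {s : Set ℝ}
    (hs : MeasurableSet s) :
    (empiricalSpectralMeasure hA : Measure ℝ).real s =
      (n : ℝ)⁻¹ * ∑ i, s.indicator 1 (hA.eigenvalues i) := by
  have h : ((empiricalSpectralMeasure hA : ProbabilityMeasure ℝ) : Measure ℝ) =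
    (n : ℝ≥0∞)⁻¹ • ∑ j, Measure.dirac (hA.eigenvalues j) := rfl
  rw [h, measureReal_ennreal_smul_apply, Measure.real, Measure.finsetSum_apply,
    ENNReal.toReal_sum (fun _ _ => measure_ne_top _ _)]
  congr 1
  · simp
  · refine Finset.sum_congr rfl fun i _ => ?_
    rw [Measure.dirac_apply' _ hs]
    by_cases hi : hA.eigenvalues i ∈ s <;> simp [hi]

/-- The mass of a set under the empirical spectral measure of `A` is controlled by the mass of its
`δ`-thickening for `B`: this is Markov's inequality for the coupling by squared overlaps. -/
lemma empiricalSpectralMeasure_real_le [NeZero n] (hA : A.IsHermitian) (hB : B.IsHermitian)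
    {s : Set ℝ} (hs : MeasurableSet s) {δ : ℝ} (hδ : 0 < δ) :
    (empiricalSpectralMeasure hA : Measure ℝ).real s ≤
      (empiricalSpectralMeasure hB : Measure ℝ).real (Metric.thickening δ s) +
        ((n : ℝ)⁻¹ * ∑ i, ∑ j, (A i j - B i j) ^ 2) / δ ^ 2 := by
  set S := fun i j => overlap hA hB i j ^ 2
  set g : ℝ → ℝ := s.indicator 1
  set h : ℝ → ℝ := (Metric.thickening δ s).indicator 1
  rw [empiricalSpectralMeasure_real hA hs,
    empiricalSpectralMeasure_real hB Metric.isOpen_thickening.measurableSet,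
    mul_div_assoc, ← mul_add, ← sum_overlap_sq_mul_sub_sq hA hB]
  refine mul_le_mul_of_nonneg_left ?_ (by positivity)
  have e1 : ∑ i, g (hA.eigenvalues i) = ∑ i, ∑ j, S i j * g (hA.eigenvalues i) := by
    refine Finset.sum_congr rfl fun i _ => ?_
    rw [← Finset.sum_mul, sum_overlap_sq_right, one_mul]
  have e2 : ∑ j, h (hB.eigenvalues j) = ∑ i, ∑ j, S i j * h (hB.eigenvalues j) := by
    rw [Finset.sum_comm]
    refine Finset.sum_congr rfl fun i _ => ?_
    rw [← Finset.sum_mul, sum_overlap_sq_left, one_mul]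
  rw [e1, e2, Finset.sum_div, ← Finset.sum_add_distrib]
  refine Finset.sum_le_sum fun i _ => ?_
  rw [Finset.sum_div, ← Finset.sum_add_distrib]
  refine Finset.sum_le_sum fun j _ => ?_
  rw [mul_div_assoc, ← mul_add]
  refine mul_le_mul_of_nonneg_left ?_ (sq_nonneg _)
  have hh : 0 ≤ h (hB.eigenvalues j) := Set.indicator_nonneg (fun _ _ => zero_le_one) _
  by_cases hi : hA.eigenvalues i ∈ s
  · have hg : g (hA.eigenvalues i) = 1 := by simp [g, hi]
    rw [hg]
    by_cases hj : |hA.eigenvalues i - hB.eigenvalues j| < δ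
    · have : hB.eigenvalues j ∈ Metric.thickening δ s :=
        Metric.mem_thickening_iff.2 ⟨_, hi, by rwa [dist_comm, Real.dist_eq]⟩
      have hh1 : h (hB.eigenvalues j) = 1 := by simp [h, this]
      rw [hh1]
      have : 0 ≤ (hA.eigenvalues i - hB.eigenvalues j) ^ 2 / δ ^ 2 := by positivity
      linarith
    · have : 1 ≤ (hA.eigenvalues i - hB.eigenvalues j) ^ 2 / δ ^ 2 := by
        rw [le_div_iff₀ (by positivity), one_mul, ← sq_abs (hA.eigenvalues i - _)]
        exact pow_le_pow_left₀ hδ.le (not_lt.1 hj) 2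
      linarith
  · have hg : g (hA.eigenvalues i) = 0 := by simp [g, hi]
    rw [hg]
    positivity

/-- A cubic power appears because, at distance `δ`, Markov's inequality has to give a probability
of at most `δ` from a quadratic cost. -/
lemma levyProkhorovDist_empiricalSpectralMeasure_le [NeZero n] (hA : A.IsHermitian)
    (hB : B.IsHermitian) {δ : ℝ} (hδ : 0 ≤ δ)
    (h : (n : ℝ)⁻¹ * ∑ i, ∑ j, (A i j - B i j) ^ 2 ≤ δ ^ 3) :
    levyProkhorovDist (empiricalSpectralMeasure hA : Measure ℝ)
      (empiricalSpectralMeasure hB : Measure ℝ) ≤ δ := by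
  refine levyProkhorovDist_le_of_forall_le _ _ hδ fun ε s hε hs => ?_
  have hε0 : 0 < ε := hδ.trans_lt hε
  have h1 := empiricalSpectralMeasure_real_le hA hB hs hε0
  have h2 : ((n : ℝ)⁻¹ * ∑ i, ∑ j, (A i j - B i j) ^ 2) / ε ^ 2 ≤ ε := by
    rw [div_le_iff₀ (by positivity)]
    calc _ ≤ δ ^ 3 := h
      _ ≤ ε ^ 3 := pow_le_pow_left₀ hδ hε.le 3
      _ = ε * ε ^ 2 := by ring
  rw [← ofReal_measureReal (measure_ne_top _ s),
    ← ofReal_measureReal (measure_ne_top _ (Metric.thickening ε s)),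
    ← ENNReal.ofReal_add measureReal_nonneg hε0.le]
  exact ENNReal.ofReal_le_ofReal (by linarith)

end Spectral

/-! ### Chaining along dyadic points -/

section Chaining

/-- The least dyadic point of level `k` that is larger than `t`. It is never `0`, so that a chaining
along these points also reaches `t = 0` without using the time `0`. -/
noncomputable def dyadicAbove (t : ℝ≥0) (k : ℕ) : ℝ≥0 := (⌊t * 2 ^ k⌋₊ + 1) / 2 ^ k

lemma tendsto_dyadicAbove (t : ℝ≥0) : Tendsto (dyadicAbove t) atTop (𝓝 t) := by
  have h0 : Tendsto (fun k : ℕ => t + (2⁻¹ : ℝ≥0) ^ k) atTop (𝓝 t) := by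
    simpa using (tendsto_const_nhds (x := t)).add
      (NNReal.tendsto_pow_atTop_nhds_zero_of_lt_one (r := 2⁻¹) (by
        rw [← NNReal.coe_lt_coe]; norm_num))
  refine tendsto_of_tendsto_of_tendsto_of_le_of_le tendsto_const_nhds h0 (fun k => ?_) fun k => ?_
  · rw [dyadicAbove, le_div_iff₀ (by positivity)]
    exact (Nat.lt_floor_add_one _).le
  · have : (⌊t * 2 ^ k⌋₊ : ℝ≥0) ≤ t * 2 ^ k := Nat.floor_le (by positivity)
    simp only [dyadicAbove, inv_pow]
    rw [div_le_iff₀ (by positivity), add_mul, inv_mul_cancel₀ (by positivity)]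
    gcongr

/-- The points at which the modulus and compactness conditions are imposed. -/
lemma dense_dyadic : Dense (Set.range fun p : ℕ × ℕ => ((p.2 + 1 : ℝ≥0) / 2 ^ p.1)) := fun t =>
  mem_closure_of_tendsto (tendsto_dyadicAbove t)
    (Eventually.of_forall fun k => ⟨(k, ⌊t * 2 ^ k⌋₊), rfl⟩)

variable {α : Type*} [PseudoMetricSpace α] {f : ℝ≥0 → α} {ρ : ℝ} {N k₀ : ℕ}

/-- The steps of level `k` of `f`, on `(0, N]`, are at most `ρ ^ k` for all `k ≥ k₀`. -/
def DyadicStepBound (ρ : ℝ) (N k₀ : ℕ) (f : ℝ≥0 → α) : Prop :=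
  ∀ k, k₀ ≤ k → ∀ j : ℕ, j + 2 ≤ N * 2 ^ k →
    dist (f ((j + 1) / 2 ^ k)) (f ((j + 2) / 2 ^ k)) ≤ ρ ^ k

lemma floor_add_one_le {t : ℝ≥0} (ht : t < N) (k : ℕ) : ⌊t * 2 ^ k⌋₊ + 1 ≤ N * 2 ^ k := by
  rw [Nat.succ_le_iff, Nat.floor_lt (by positivity)]
  push_cast
  gcongr

lemma DyadicStepBound.dist_dyadicAbove_succ (hf : DyadicStepBound ρ N k₀ f) (hρ : 0 ≤ ρ)
    (hρ1 : ρ ≤ 1) {t : ℝ≥0} (ht : t < N) {k : ℕ} (hk : k₀ ≤ k) :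
    dist (f (dyadicAbove t k)) (f (dyadicAbove t (k + 1))) ≤ ρ ^ k := by
  set a := ⌊t * 2 ^ k⌋₊ with ha
  have haN : a + 1 ≤ N * 2 ^ k := floor_add_one_le ht k
  have h1 : dyadicAbove t k = (2 * a + 2) / 2 ^ (k + 1) := by
    rw [dyadicAbove, ← ha, pow_succ, div_eq_div_iff (by positivity) (by positivity)]
    ring
  have hlo : 2 * a ≤ ⌊t * 2 ^ (k + 1)⌋₊ := by
    refine Nat.le_floor ?_
    have : (a : ℝ≥0) ≤ t * 2 ^ k := Nat.floor_le (by positivity)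
    push_cast
    calc (2 * a : ℝ≥0) ≤ 2 * (t * 2 ^ k) := by gcongr
      _ = t * 2 ^ (k + 1) := by ring
  have hhi : ⌊t * 2 ^ (k + 1)⌋₊ < 2 * a + 2 := by
    rw [Nat.floor_lt (by positivity)]
    have : t * 2 ^ k < a + 1 := Nat.lt_floor_add_one _
    push_cast
    calc t * 2 ^ (k + 1) = 2 * (t * 2 ^ k) := by ring
      _ < 2 * (a + 1) := by gcongr
      _ = 2 * a + 2 := by ring
  obtain h | h : ⌊t * 2 ^ (k + 1)⌋₊ = 2 * a ∨ ⌊t * 2 ^ (k + 1)⌋₊ = 2 * a + 1 := by omega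
  · have h2 : dyadicAbove t (k + 1) = (2 * a + 1) / 2 ^ (k + 1) := by
      rw [dyadicAbove, h]; push_cast; rfl
    rw [h1, h2, dist_comm]
    have := hf (k + 1) (by omega) (2 * a) (by rw [pow_succ]; linarith)
    push_cast at this
    exact this.trans (pow_le_pow_of_le_one hρ hρ1 (Nat.le_succ k))
  · have h2 : dyadicAbove t (k + 1) = (2 * a + 2) / 2 ^ (k + 1) := by
      rw [dyadicAbove, h]; push_cast; ring
    rw [h1, h2, dist_self]
    positivity

lemma DyadicStepBound.dist_dyadicAbove (hf : DyadicStepBound ρ N k₀ f) (hfc : Continuous f)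
    (hρ : 0 ≤ ρ) (hρ1 : ρ < 1) {t : ℝ≥0} (ht : t < N) {m : ℕ} (hm : k₀ ≤ m) :
    dist (f (dyadicAbove t m)) (f t) ≤ ρ ^ m / (1 - ρ) := by
  have hlim : Tendsto (fun n => f (dyadicAbove t (m + n))) atTop (𝓝 (f t)) := by
    refine (hfc.tendsto t).comp ((tendsto_dyadicAbove t).comp ?_)
    simpa only [add_comm] using tendsto_add_atTop_nat m
  refine dist_le_of_le_geometric_of_tendsto₀ ρ (ρ ^ m) hρ1 (fun n => ?_) hlim
  rw [← pow_add]
  exact hf.dist_dyadicAbove_succ hρ hρ1.le ht (by omega)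

/-- Control of a continuous path at dyadic points gives a modulus of continuity on `[0, N)`. -/
lemma DyadicStepBound.dist_le (hf : DyadicStepBound ρ N k₀ f) (hfc : Continuous f)
    (hρ : 0 ≤ ρ) (hρ1 : ρ < 1) {m : ℕ} (hm : k₀ ≤ m) {s t : ℝ≥0} (hs : s < N) (ht : t < N)
    (hst : dist s t < (2⁻¹ : ℝ) ^ m) : dist (f s) (f t) ≤ 3 * (ρ ^ m / (1 - ρ)) := by
  wlog hle : s ≤ t generalizing s t
  · rw [dist_comm]
    exact this ht hs (by rwa [dist_comm]) (le_of_not_ge hle)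
  have h1 := hf.dist_dyadicAbove hfc hρ hρ1 hs hm
  have h2 := hf.dist_dyadicAbove hfc hρ hρ1 ht hm
  have hpow : ρ ^ m ≤ ρ ^ m / (1 - ρ) := by
    rw [le_div_iff₀ (by linarith)]
    nlinarith [pow_nonneg hρ m]
  have h3 : dist (f (dyadicAbove s m)) (f (dyadicAbove t m)) ≤ ρ ^ m := by
    set a := ⌊s * 2 ^ m⌋₊ with ha
    have hab : a ≤ ⌊t * 2 ^ m⌋₊ := Nat.floor_mono (by gcongr)
    have hba : ⌊t * 2 ^ m⌋₊ < a + 2 := by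
      rw [Nat.floor_lt (by positivity)]
      have hs' : s * 2 ^ m < a + 1 := Nat.lt_floor_add_one _
      have ht' : t * 2 ^ m ≤ s * 2 ^ m + 1 := by
        rw [NNReal.dist_eq, abs_sub_comm, inv_pow] at hst
        have := (le_abs_self _).trans hst.le
        rw [← NNReal.coe_le_coe]
        push_cast
        have h2m : (0 : ℝ) < 2 ^ m := by positivity
        have := mul_le_mul_of_nonneg_right this h2m.le
        rw [inv_mul_cancel₀ h2m.ne', sub_mul] at this
        linarith
      push_cast
      calc t * 2 ^ m ≤ s * 2 ^ m + 1 := ht'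
        _ < a + 1 + 1 := by gcongr
        _ = a + 2 := by ring
    have htN := floor_add_one_le ht m
    obtain h | h : ⌊t * 2 ^ m⌋₊ = a ∨ ⌊t * 2 ^ m⌋₊ = a + 1 := by omega
    · rw [dyadicAbove, dyadicAbove, h, dist_self]
      positivity
    · rw [dyadicAbove, dyadicAbove, h, ← ha]
      have := hf m hm a (by omega)
      push_cast
      rwa [add_assoc (a : ℝ≥0), one_add_one_eq_two]
  calc dist (f s) (f t) ≤ dist (f s) (f (dyadicAbove s m)) +
        dist (f (dyadicAbove s m)) (f (dyadicAbove t m)) + dist (f (dyadicAbove t m)) (f t) :=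
        dist_triangle4 _ _ _ _
    _ ≤ ρ ^ m / (1 - ρ) + ρ ^ m + ρ ^ m / (1 - ρ) := by
        rw [dist_comm (f s)]
        gcongr
    _ ≤ _ := by linarith

lemma equicontinuous_of_dyadicStepBound (hρ : 0 ≤ ρ) (hρ1 : ρ < 1) (k₀ : ℕ → ℕ)
    {S : Set C(ℝ≥0, α)} (hS : ∀ f ∈ S, ∀ N, DyadicStepBound ρ N (k₀ N) f) :
    Equicontinuous ((↑) : S → ℝ≥0 → α) := by
  intro x
  rw [Metric.equicontinuousAt_iff_right]
  intro ε hε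
  obtain ⟨N, hN⟩ := exists_nat_gt x
  have hlim : Tendsto (fun m => 3 * (ρ ^ m / (1 - ρ))) atTop (𝓝 0) := by
    simpa using ((tendsto_pow_atTop_nhds_zero_of_lt_one hρ hρ1).div_const (1 - ρ)).const_mul 3
  obtain ⟨m, hm, hmk⟩ := ((hlim.eventually_lt_const hε).and (eventually_ge_atTop (k₀ N))).exists
  filter_upwards [Iio_mem_nhds hN, Metric.ball_mem_nhds x (by positivity : (0:ℝ) < (2⁻¹ : ℝ) ^ m)]
    with y hy hxy i
  refine ((hS i i.2 N).dist_le i.1.continuous hρ hρ1 hmk hN hy ?_).trans_lt hm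
  rw [dist_comm]
  exact hxy

end Chaining

/-! ### Tightness of laws of continuous processes -/

/-- The Arzelà–Ascoli theorem for functions with values in a complete space: pointwise relative
compactness is needed on a dense set only. -/
lemma isCompact_closure_of_equicontinuous_of_dense {X α : Type*} [TopologicalSpace X]
    [CompactlyCoherentSpace X] [MetricSpace α] [CompleteSpace α] {S : Set C(X, α)}
    (hS : Equicontinuous ((↑) : S → X → α)) {D : Set X} (hD : Dense D)
    (hQ : ∀ x ∈ D, ∃ Q, IsCompact Q ∧ ∀ f ∈ S, f x ∈ Q) : IsCompact (closure S) := by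
  have hemb : Topology.IsClosedEmbedding (UniformOnFun.ofFun {K : Set X | IsCompact K} ∘
      (DFunLike.coe : C(X, α) → X → α)) := by
    refine ⟨ContinuousMap.isUniformEmbedding_toUniformOnFunIsCompact.isEmbedding, ?_⟩
    have := ContinuousMap.range_toUniformOnFunIsCompact (α := X) (β := α)
    exact this ▸ UniformOnFun.isClosed_setOfPred_continuous CompactlyCoherentSpace.isCoherentWith
  refine ArzelaAscoli.isCompact_closure_of_isClosedEmbedding (fun K hK => hK) hemb
    (fun K _ => hS.equicontinuousOn K) fun K _ x _ => ?_
  refine ⟨closure ((fun f : C(X, α) => f x) '' S), ?_, fun f hf =>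
    subset_closure (Set.mem_image_of_mem _ hf)⟩
  refine TotallyBounded.isCompact_of_isClosed (TotallyBounded.closure ?_) isClosed_closure
  rw [Metric.totallyBounded_iff]
  intro ε hε
  -- compare with the values at a nearby point of the dense set
  obtain ⟨y, hyD, hy⟩ := hD.inter_nhds_nonempty
    (Metric.equicontinuousAt_iff_right.1 (hS x) (ε / 2) (half_pos hε))
  obtain ⟨Q, hQc, hQS⟩ := hQ y hyD
  obtain ⟨T, hT, hTQ⟩ := Metric.totallyBounded_iff.1 hQc.totallyBounded (ε / 2) (half_pos hε)
  refine ⟨T, hT, ?_⟩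
  rintro _ ⟨f, hf, rfl⟩
  obtain ⟨z, hz, hfz⟩ := Set.mem_iUnion₂.1 (hTQ (hQS f hf))
  refine Set.mem_iUnion₂.2 ⟨z, hz, ?_⟩
  have h1 : dist (f x) (f y) < ε / 2 := hy ⟨f, hf⟩
  have h2 : dist (f y) z < ε / 2 := hfz
  exact (dist_triangle _ (f y) _).trans_lt (by linarith)

/-- A Kolmogorov-type tightness criterion. The increments are controlled at consecutive dyadic
points of `(0, ∞)` only: for each level `k` there are `O(2 ^ k)` of these in a bounded interval,
each of which is large with probability `O(4 ^ (-k))`. -/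
theorem isTightMeasureSet_of_dyadic {Ω ι α : Type*} [MeasurableSpace Ω] {P : Measure Ω}
    [MetricSpace α] [CompleteSpace α] [MeasurableSpace C(ℝ≥0, α)] [BorelSpace C(ℝ≥0, α)]
    {M : ι → Ω → C(ℝ≥0, α)} (hM : ∀ i, Measurable (M i)) {ρ : ℝ} (hρ : 0 ≤ ρ) (hρ1 : ρ < 1)
    {c : ℝ≥0}
    (hstep : ∀ i k (j : ℕ), P {ω | ρ ^ k <
      dist (M i ω ((j + 1) / 2 ^ k)) (M i ω ((j + 2) / 2 ^ k))} ≤ c * (4⁻¹ : ℝ≥0∞) ^ k)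
    (hpt : ∀ t : ℝ≥0, 0 < t → ∀ ε : ℝ≥0∞, 0 < ε → ∃ Q : Set α, IsCompact Q ∧
      ∀ i, P {ω | M i ω t ∉ Q} ≤ ε) :
    IsTightMeasureSet (Set.range fun i => P.map (M i)) := by
  rw [isTightMeasureSet_iff_exists_isCompact_measure_compl_le]
  intro ε hε
  have hε2 : ε / 2 ≠ 0 := (ENNReal.half_pos hε.ne').ne'
  obtain ⟨ε₁, hε₁, hε₁sum⟩ := ENNReal.exists_pos_sum_of_countable hε2 ℕ
  obtain ⟨ε₂, hε₂, hε₂sum⟩ := ENNReal.exists_pos_sum_of_countable hε2 (ℕ × ℕ)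
  choose Q hQc hQ using fun p : ℕ × ℕ =>
    hpt ((p.2 + 1) / 2 ^ p.1) (by positivity) (ε₂ p) (by exact_mod_cast hε₂ p)
  -- the level from which the steps on `[0, N]` are summable with a small sum
  have hk : ∀ N : ℕ, ∃ k₀ : ℕ, ∑' k, (N * c : ℝ≥0∞) * 2⁻¹ ^ (k + k₀) ≤ ε₁ N := by
    intro N
    have hsum : ∑' k : ℕ, (N * c : ℝ≥0∞) * 2⁻¹ ^ k ≠ ∞ := by
      rw [ENNReal.tsum_mul_left, ENNReal.tsum_geometric, ENNReal.one_sub_inv_two, inv_inv]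
      finiteness
    exact ((ENNReal.tendsto_sum_nat_add _ hsum).eventually_le_const
      (by exact_mod_cast hε₁ N)).exists
  choose k₀ hk₀ using hk
  set S : Set C(ℝ≥0, α) := {f | (∀ N, DyadicStepBound ρ N (k₀ N) f) ∧
    ∀ p : ℕ × ℕ, f ((p.2 + 1) / 2 ^ p.1) ∈ Q p}
  have hSc : IsCompact (closure S) := by
    refine isCompact_closure_of_equicontinuous_of_dense
      (equicontinuous_of_dyadicStepBound hρ hρ1 k₀ fun f hf => hf.1) dense_dyadic ?_
    rintro _ ⟨p, rfl⟩
    exact ⟨Q p, hQc p, fun f hf => hf.2 p⟩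
  refine ⟨closure S, hSc, ?_⟩
  rintro _ ⟨i, rfl⟩
  rw [Measure.map_apply (hM i) hSc.isClosed.measurableSet.compl]
  have hsub : M i ⁻¹' (closure S)ᶜ ⊆
      (⋃ N : ℕ, ⋃ k : ℕ, ⋃ j ∈ Finset.range (N * 2 ^ (k + k₀ N)),
        {ω | ρ ^ (k + k₀ N) < dist (M i ω ((j + 1) / 2 ^ (k + k₀ N)))
          (M i ω ((j + 2) / 2 ^ (k + k₀ N)))}) ∪
      ⋃ p : ℕ × ℕ, {ω | M i ω ((p.2 + 1) / 2 ^ p.1) ∉ Q p} := by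
    intro ω hω
    by_contra hcon
    refine hω (subset_closure ?_)
    simp only [Set.mem_union, Set.mem_iUnion, Set.mem_ofPred_eq, not_or, not_exists, not_lt,
      not_not, Finset.mem_range] at hcon
    refine ⟨fun N k hk j hj => ?_, hcon.2⟩
    have := hcon.1 N (k - k₀ N) j
    rw [Nat.sub_add_cancel hk] at this
    exact this (by omega)
  have hN : ∀ N : ℕ, P (⋃ k : ℕ, ⋃ j ∈ Finset.range (N * 2 ^ (k + k₀ N)),
        {ω | ρ ^ (k + k₀ N) < dist (M i ω ((j + 1) / 2 ^ (k + k₀ N)))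
          (M i ω ((j + 2) / 2 ^ (k + k₀ N)))}) ≤ ε₁ N := by
    intro N
    refine (measure_iUnion_le _).trans ((ENNReal.tsum_le_tsum fun k => ?_).trans (hk₀ N))
    refine (measure_biUnion_finset_le _ _).trans ?_
    refine (Finset.sum_le_sum fun j _ => hstep i (k + k₀ N) j).trans ?_
    rw [Finset.sum_const, Finset.card_range, nsmul_eq_mul]
    have h4 : (4⁻¹ : ℝ≥0∞) = 2⁻¹ * 2⁻¹ := by
      rw [← ENNReal.mul_inv (by simp) (by simp)]; norm_num
    have h2 : (2 : ℝ≥0∞) ^ (k + k₀ N) * 2⁻¹ ^ (k + k₀ N) = 1 := by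
      rw [← mul_pow, ENNReal.mul_inv_cancel (by simp) (by simp), one_pow]
    rw [h4, mul_pow]
    push_cast
    calc (N * 2 ^ (k + k₀ N) * (c * (2⁻¹ ^ (k + k₀ N) * 2⁻¹ ^ (k + k₀ N))) : ℝ≥0∞)
        = N * c * 2⁻¹ ^ (k + k₀ N) * (2 ^ (k + k₀ N) * 2⁻¹ ^ (k + k₀ N)) := by ring
      _ ≤ _ := by rw [h2, mul_one]
  calc P (M i ⁻¹' (closure S)ᶜ) ≤ _ := measure_mono hsub
    _ ≤ _ := measure_union_le _ _
    _ ≤ ∑' N, (ε₁ N : ℝ≥0∞) + ∑' p, (ε₂ p : ℝ≥0∞) := by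
        refine add_le_add ?_ ?_
        · exact (measure_iUnion_le _).trans (ENNReal.tsum_le_tsum hN)
        · exact (measure_iUnion_le _).trans (ENNReal.tsum_le_tsum fun p => hQ p i)
    _ ≤ ε / 2 + ε / 2 := add_le_add hε₁sum.le hε₂sum.le
    _ = ε := ENNReal.add_halves ε

/-! ### The Lévy–Prokhorov metric on probability measures -/

section LevyProkhorov

variable {E : Type*} [NormedAddCommGroup E] [ProperSpace E] [MeasurableSpace E] [BorelSpace E]

variable (E) in
/-- The Lévy–Prokhorov metric, as a metric space structure on `ProbabilityMeasure E` whose topology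
is definitionally the topology of weak convergence. -/
noncomputable abbrev levyProkhorovMetricSpace : MetricSpace (ProbabilityMeasure E) :=
  (LevyProkhorov.probabilityMeasureHomeomorph (Ω := E)).isEmbedding.comapMetricSpace _

attribute [local instance] levyProkhorovMetricSpace

lemma dist_eq_levyProkhorovDist (μ ν : ProbabilityMeasure E) :
    dist μ ν = levyProkhorovDist (μ : Measure E) (ν : Measure E) := rfl

/-- The thickening in the Lévy–Prokhorov distance moves mass by a bounded distance only, so all but
finitely many terms inherit the tightness of a single one. -/
lemma isTightMeasureSet_range_of_cauchySeq {u : ℕ → ProbabilityMeasure E} (hu : CauchySeq u) :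
    IsTightMeasureSet (Set.range fun n => (u n : Measure E)) := by
  refine isTightMeasureSet_range_of_tendsto_limsup_measure_norm_gt ?_
  rw [ENNReal.tendsto_atTop_zero]
  intro ε hε
  obtain ⟨δ, hδ, hδε⟩ := ENNReal.exists_nnreal_pos_mul_lt (a := 2) (by simp) hε.ne'
  obtain ⟨N, hN⟩ := Metric.cauchySeq_iff'.1 hu δ (by exact_mod_cast hδ)
  have hT := tendsto_measure_norm_gt_of_isTightMeasureSet
    (isTightMeasureSet_singleton (μ := (u N : Measure E)))
  rw [ENNReal.tendsto_atTop_zero] at hT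
  obtain ⟨R, hR⟩ := hT δ (by exact_mod_cast hδ)
  refine ⟨R + δ, fun r hr => limsup_le_of_le (by isBoundedDefault) ?_⟩
  filter_upwards [eventually_ge_atTop N] with n hn
  have hlt : levyProkhorovEDist (u n : Measure E) (u N : Measure E) < δ := by
    have h := hN n hn
    rw [dist_eq_levyProkhorovDist, levyProkhorovDist] at h
    rwa [← ENNReal.toReal_lt_toReal (levyProkhorovEDist_ne_top _ _) ENNReal.coe_ne_top]
  have hmeas : MeasurableSet {x : E | r < ‖x‖} :=
    measurableSet_lt measurable_const measurable_norm
  refine (left_measure_le_of_levyProkhorovEDist_lt hlt hmeas).trans (le_trans ?_ hδε.le)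
  have hsub : Metric.thickening (δ : ℝ≥0∞).toReal {x : E | r < ‖x‖} ⊆ {x | r - δ < ‖x‖} := by
    intro x hx
    obtain ⟨y, hy, hxy⟩ := Metric.mem_thickening_iff.1 hx
    have h1 : r < ‖y‖ := hy
    have h2 : ‖y‖ ≤ ‖x‖ + dist x y := by
      rw [dist_comm, dist_eq_norm]
      simpa [add_comm] using norm_le_norm_add_norm_sub' y x
    have h3 : dist x y < δ := hxy
    change r - δ < ‖x‖
    linarith
  have h1 : (u N : Measure E) {x | r - δ < ‖x‖} ≤ δ := by
    simpa using hR (r - δ) (by linarith)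
  calc _ ≤ (δ : ℝ≥0∞) + δ := add_le_add ((measure_mono hsub).trans h1) le_rfl
    _ = δ * 2 := by rw [mul_two]
    _ = _ := by rfl

lemma completeSpace_probabilityMeasure : CompleteSpace (ProbabilityMeasure E) := by
  refine Metric.complete_of_cauchySeq_tendsto fun u hu => ?_
  have hK : IsCompact (closure (Set.range u)) := by
    refine isCompact_closure_of_isTightMeasureSet ?_
    convert! isTightMeasureSet_range_of_cauchySeq hu
    ext μ
    simp
  obtain ⟨μ, -, hμ⟩ := cauchySeq_tendsto_of_isComplete hK.isComplete
    (fun n => subset_closure (Set.mem_range_self n)) hu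
  exact ⟨μ, hμ⟩

end LevyProkhorov

/-! ### Moments of Gaussian increments -/

section Moments

variable {Ω : Type*} [MeasurableSpace Ω] {P : Measure Ω}

lemma integral_even_pow_of_hasGaussianLaw {Z : Ω → ℝ} (hZ : HasGaussianLaw Z P)
    (h0 : ∫ ω, Z ω ∂P = 0) (m : ℕ) :
    ∫ ω, Z ω ^ (2 * m) ∂P =
      (∫ ω, Z ω ^ 2 ∂P) ^ m * ∫ x, x ^ (2 * m) ∂(gaussianReal 0 1) := by
  have hP : IsProbabilityMeasure P := hZ.isProbabilityMeasure
  have hv : Var[Z; P] = ∫ ω, Z ω ^ 2 ∂P := variance_of_integral_eq_zero hZ.aemeasurable h0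
  have hlaw : P.map Z = (gaussianReal 0 1).map (fun x => √(∫ ω, Z ω ^ 2 ∂P) * x) := by
    rw [hZ.map_eq_gaussianReal, gaussianReal_map_const_mul, h0, mul_zero, hv, mul_one]
    congr 1
    ext
    have hnn : 0 ≤ ∫ ω, Z ω ^ 2 ∂P := integral_nonneg fun ω => sq_nonneg _
    simp [Real.sq_sqrt hnn, hnn]
  rw [← integral_map (f := fun x => x ^ (2 * m)) hZ.aemeasurable
    (by fun_prop), hlaw, integral_map (by fun_prop) (by fun_prop), ← integral_const_mul]
  congr 1
  ext x
  rw [mul_pow, pow_mul √_, Real.sq_sqrt (integral_nonneg fun ω => sq_nonneg _)]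

/-- Markov's inequality for the `m`-th power of a mean of squares. -/
lemma measureReal_lt_mean_sq_le [IsFiniteMeasure P] {ι : Type*} [Fintype ι] [Nonempty ι]
    {Z : ι → Ω → ℝ} {m : ℕ} {L : ℝ} (hint : ∀ i, Integrable (fun ω => Z i ω ^ (2 * m)) P)
    (hL : ∀ i, ∫ ω, Z i ω ^ (2 * m) ∂P ≤ L) {a : ℝ} (ha : 0 < a) :
    P.real {ω | a < (Fintype.card ι : ℝ)⁻¹ * ∑ i, Z i ω ^ 2} ≤ L / a ^ m := by
  have hcard : (0 : ℝ) < Fintype.card ι := by exact_mod_cast Fintype.card_pos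
  set f : Ω → ℝ := fun ω => (Fintype.card ι : ℝ)⁻¹ * ∑ i, Z i ω ^ (2 * m) with hf
  have hf0 : ∀ ω, 0 ≤ f ω := fun ω => mul_nonneg (by positivity)
    (Finset.sum_nonneg fun i _ => by rw [pow_mul]; positivity)
  have hfi : Integrable f P := (integrable_finsetSum _ fun i _ => hint i).const_mul _
  have hsub : {ω | a < (Fintype.card ι : ℝ)⁻¹ * ∑ i, Z i ω ^ 2} ⊆ {ω | a ^ m ≤ f ω} := by
    intro ω hω
    have hω' : a < (Fintype.card ι : ℝ)⁻¹ * ∑ i, Z i ω ^ 2 := hω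
    have hJ := Real.pow_arith_mean_le_arith_mean_pow Finset.univ
      (fun _ : ι => (Fintype.card ι : ℝ)⁻¹) (fun i => Z i ω ^ 2) (fun _ _ => by positivity)
      (by simp [hcard.ne']) (fun _ _ => sq_nonneg _) m
    simp_rw [← Finset.mul_sum, ← pow_mul] at hJ
    exact (pow_le_pow_left₀ ha.le hω'.le m).trans hJ
  rw [le_div_iff₀ (by positivity), mul_comm]
  calc a ^ m * P.real {ω | a < (Fintype.card ι : ℝ)⁻¹ * ∑ i, Z i ω ^ 2}
      ≤ a ^ m * P.real {ω | a ^ m ≤ f ω} :=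
        mul_le_mul_of_nonneg_left (measureReal_mono hsub (measure_ne_top P _)) (by positivity)
    _ ≤ ∫ ω, f ω ∂P := mul_meas_ge_le_integral_of_nonneg (Eventually.of_forall hf0) hfi _
    _ = (Fintype.card ι : ℝ)⁻¹ * ∑ i, ∫ ω, Z i ω ^ (2 * m) ∂P := by
        rw [hf, integral_const_mul, integral_finsetSum _ fun i _ => hint i]
    _ ≤ (Fintype.card ι : ℝ)⁻¹ * ∑ _i : ι, L := by
        gcongr with i
        exact hL i
    _ = L := by
        rw [Finset.sum_const, Finset.card_univ, nsmul_eq_mul, inv_mul_cancel_left₀ hcard.ne']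

/-- The bound depends neither on the number of variables nor on their joint law. -/
lemma measure_lt_mean_sq_le_of_hasGaussianLaw {ι : Type*} [Fintype ι] [Nonempty ι]
    {Z : ι → Ω → ℝ} (hZ : ∀ i, HasGaussianLaw (Z i) P) (h0 : ∀ i, ∫ ω, Z i ω ∂P = 0)
    {v : ℝ} (hv : ∀ i, ∫ ω, Z i ω ^ 2 ∂P ≤ v) (m : ℕ) {a : ℝ} (ha : 0 < a) :
    P {ω | a < (Fintype.card ι : ℝ)⁻¹ * ∑ i, Z i ω ^ 2} ≤
      ENNReal.ofReal ((v / a) ^ m * ∫ x, x ^ (2 * m) ∂(gaussianReal 0 1)) := by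
  have hP : IsProbabilityMeasure P := (hZ (Classical.arbitrary ι)).isProbabilityMeasure
  have hc : 0 ≤ ∫ x, x ^ (2 * m) ∂(gaussianReal 0 1) :=
    integral_nonneg fun x => by simp only [pow_mul, Pi.zero_apply]; positivity
  have hint : ∀ i, Integrable (fun ω => Z i ω ^ (2 * m)) P := fun i => by
    have h := ((hZ i).memLp (p := (2 * m : ℕ)) (ENNReal.natCast_ne_top _)).integrable_norm_pow'
    simpa [pow_mul] using h
  rw [← ofReal_measureReal (measure_ne_top _ _)]
  refine ENNReal.ofReal_le_ofReal ?_
  refine (measureReal_lt_mean_sq_le (L := v ^ m * ∫ x, x ^ (2 * m) ∂(gaussianReal 0 1)) hint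
    (fun i => ?_) ha).trans_eq ?_
  · rw [integral_even_pow_of_hasGaussianLaw (hZ i) (h0 i)]
    gcongr
    exact hv i
  · rw [div_pow]
    ring

end Moments

/-! ### The spectral process of a Gaussian array -/

section Entries

/-- The array enters with weight `1 / √n` or `√2 / √n`, and the entry at `(i, j)` is built from the
array at `(min i j, max i j)`. -/
lemma renormalizedMatrix_sub_sq_le {n : ℕ} (x y : ℕ → ℕ → ℝ) (A : Matrix (Fin n) (Fin n) ℝ)
    (i j : Fin n) :
    (renormalizedMatrix x A i j - renormalizedMatrix y A i j) ^ 2 ≤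
      2 / n *
        (x (min i j : Fin n) (max i j : Fin n) - y (min i j : Fin n) (max i j : Fin n)) ^ 2 := by
  have hsq : ∀ z : ℝ, (1 / √(n : ℝ) * z) ^ 2 ≤ 2 / n * z ^ 2 := fun z => by
    rw [mul_pow, div_pow, Real.sq_sqrt (by positivity), one_pow]
    gcongr
    norm_num
  simp only [renormalizedMatrix, Matrix.of_apply]
  rcases lt_trichotomy i j with h | h | h
  · rw [if_pos h, if_pos h, min_eq_left h.le, max_eq_right h.le, add_sub_add_right_eq_sub,
      ← mul_sub]
    exact hsq _
  · subst h
    rw [if_neg (lt_irrefl _), if_neg (lt_irrefl _), if_pos rfl, if_pos rfl, min_self, max_self,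
      add_sub_add_right_eq_sub, ← mul_sub, mul_pow, div_pow, Real.sq_sqrt (by positivity),
      Real.sq_sqrt (by positivity)]
  · rw [if_neg h.not_gt, if_neg h.not_gt, if_neg h.ne', if_neg h.ne', min_eq_right h.le,
      max_eq_left h.le, add_sub_add_right_eq_sub, ← mul_sub]
    exact hsq _

lemma renormalizedMatrix_zero {n : ℕ} {A : Matrix (Fin n) (Fin n) ℝ} (hA : A.IsHermitian) :
    renormalizedMatrix (fun _ _ => 0) A = A := by
  ext i j
  have h : A j i = A i j := by simpa using hA.apply i j
  simp only [renormalizedMatrix, Matrix.of_apply, mul_zero, zero_add]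
  split_ifs with h1 h2
  · rfl
  · rw [h2]
  · exact h

lemma normalized_sum_sub_sq_le {n : ℕ} [NeZero n] (x y : ℕ → ℕ → ℝ)
    (A : Matrix (Fin n) (Fin n) ℝ) :
    (n : ℝ)⁻¹ * ∑ i, ∑ j, (renormalizedMatrix x A i j - renormalizedMatrix y A i j) ^ 2 ≤
      2 * ((Fintype.card (Fin n × Fin n) : ℝ)⁻¹ * ∑ p : Fin n × Fin n,
        (x (min p.1 p.2 : Fin n) (max p.1 p.2 : Fin n) -
          y (min p.1 p.2 : Fin n) (max p.1 p.2 : Fin n)) ^ 2) := by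
  rw [Fintype.sum_prod_type]
  calc _ ≤ (n : ℝ)⁻¹ * ∑ i, ∑ j, 2 / n * (x (min i j : Fin n) (max i j : Fin n) -
        y (min i j : Fin n) (max i j : Fin n)) ^ 2 := by
        gcongr with i _ j _
        exact renormalizedMatrix_sub_sq_le x y A i j
    _ = _ := by
        simp_rw [← Finset.mul_sum]
        rw [Fintype.card_prod, Fintype.card_fin]
        push_cast
        field_simp

variable {Ω : Type*} [MeasurableSpace Ω] {P : Measure Ω} {X : ℕ → ℕ → ℝ≥0 → Ω → ℝ}
  {R : ℝ≥0 → ℝ≥0 → ℝ}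

lemma integral_increment_sq (hgauss : ∀ i j, IsGaussianProcess (X i j) P)
    (hcov : ∀ i j s t, ∫ ω, X i j s ω * X i j t ω ∂P = R s t) (i j : ℕ) (s t : ℝ≥0) :
    ∫ ω, (X i j s ω - X i j t ω) ^ 2 ∂P = R s s - 2 * R s t + R t t := by
  have h2 : ∀ u, MemLp (X i j u) 2 P := fun u => ((hgauss i j).hasGaussianLaw_eval u).memLp_two
  have hI : ∀ u v, Integrable (fun ω => X i j u ω * X i j v ω) P := fun u v =>
    (h2 u).integrable_mul (h2 v)
  have e : ∀ ω, (X i j s ω - X i j t ω) ^ 2 =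
      X i j s ω * X i j s ω - 2 * (X i j s ω * X i j t ω) + X i j t ω * X i j t ω := fun ω => by
    ring
  simp_rw [e]
  rw [integral_add (f := fun ω => X i j s ω * X i j s ω - 2 * (X i j s ω * X i j t ω))
      ((hI s s).sub ((hI s t).const_mul 2)) (hI t t),
    integral_sub (hI s s) ((hI s t).const_mul 2), integral_const_mul, hcov, hcov, hcov]

/-- Increments of the spectral process in the Lévy–Prokhorov metric. -/
lemma measure_lt_levyProkhorovDist_spectralProcess_le
    (hgauss : ∀ i j, IsGaussianProcess (X i j) P) (hmean : ∀ i j t, ∫ ω, X i j t ω ∂P = 0)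
    (hcov : ∀ i j s t, ∫ ω, X i j s ω * X i j t ω ∂P = R s t) {n : ℕ} [NeZero n]
    (A : Matrix (Fin n) (Fin n) ℝ) (s t : ℝ≥0) (m : ℕ) {v δ : ℝ}
    (hv : R s s - 2 * R s t + R t t ≤ v) (hδ : 0 < δ) :
    P {ω | δ < levyProkhorovDist (spectralProcess X A s ω : Measure ℝ)
        (spectralProcess X A t ω : Measure ℝ)} ≤
      ENNReal.ofReal ((v / (δ ^ 3 / 2)) ^ m * ∫ x, x ^ (2 * m) ∂(gaussianReal 0 1)) := by
  set Z : Fin n × Fin n → Ω → ℝ := fun p ω => X (min p.1 p.2 : Fin n) (max p.1 p.2 : Fin n) s ω -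
    X (min p.1 p.2 : Fin n) (max p.1 p.2 : Fin n) t ω with hZ
  refine (measure_mono fun ω hω => ?_).trans
    (measure_lt_mean_sq_le_of_hasGaussianLaw (Z := Z) (fun p => (hgauss _ _).hasGaussianLaw_fun_sub)
      (fun p => ?_) (v := v) (fun p => ?_) m (a := δ ^ 3 / 2) (by positivity))
  · have hω' : δ < _ := hω
    by_contra hcon
    refine hω'.not_ge (levyProkhorovDist_empiricalSpectralMeasure_le _ _ hδ.le ?_)
    refine (normalized_sum_sub_sq_le _ _ A).trans ?_
    have : (Fintype.card (Fin n × Fin n) : ℝ)⁻¹ * ∑ p, Z p ω ^ 2 ≤ δ ^ 3 / 2 := not_lt.1 hcon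
    change 2 * ((Fintype.card (Fin n × Fin n) : ℝ)⁻¹ * ∑ p, Z p ω ^ 2) ≤ δ ^ 3
    linarith
  · have hI : ∀ u, Integrable (X (min p.1 p.2 : Fin n) (max p.1 p.2 : Fin n) u) P := fun u =>
      ((hgauss _ _).hasGaussianLaw_eval u).integrable
    simp only [hZ]
    rw [integral_sub (hI s) (hI t), hmean, hmean, sub_zero]
  · simp only [hZ]
    rw [integral_increment_sq hgauss hcov]
    exact hv

/-- At dyadic points the increments of the spectral process satisfy the bounds of the tightness
criterion, uniformly in the dimension. -/
lemma exists_dyadic_increment_bound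
    (hgauss : ∀ i j, IsGaussianProcess (X i j) P) (hmean : ∀ i j t, ∫ ω, X i j t ω ∂P = 0)
    (hcov : ∀ i j s t, ∫ ω, X i j s ω * X i j t ω ∂P = R s t) (hR : IncrementCondition R) :
    ∃ (ρ : ℝ) (c : ℝ≥0), 0 < ρ ∧ ρ < 1 ∧ ∀ (n : ℕ) [NeZero n] (A : Matrix (Fin n) (Fin n) ℝ)
      (k j : ℕ), P {ω | ρ ^ k < levyProkhorovDist
        (spectralProcess X A ((j + 1) / 2 ^ k) ω : Measure ℝ)
        (spectralProcess X A ((j + 2) / 2 ^ k) ω : Measure ℝ)} ≤ c * (4⁻¹ : ℝ≥0∞) ^ k := by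
  obtain ⟨κ, γ, hκ, hγ, hR⟩ := hR
  -- with `q = 2 ^ (-γ / 2)` the variance over a time `2 ^ (-k)` is at most `κ q ^ (2 k)`, whereas
  -- the cubed threshold is `q ^ k`; then `m` is such that the ratio `q ^ k` has an `m`-th power
  -- below `4 ^ (-k)`
  set ρ : ℝ := 2 ^ (-γ / 6) with hρ
  set q : ℝ := 2 ^ (-γ / 2) with hq
  have hρ0 : 0 < ρ := by positivity
  have hq0 : 0 < q := by positivity
  have hρ1 : ρ < 1 := Real.rpow_lt_one_of_one_lt_of_neg one_lt_two (by linarith)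
  have hq1 : q < 1 := Real.rpow_lt_one_of_one_lt_of_neg one_lt_two (by linarith)
  have hρq : ρ ^ 3 = q := by
    rw [hρ, hq, ← Real.rpow_natCast, ← Real.rpow_mul (by norm_num)]
    congr 1
    push_cast
    ring
  obtain ⟨m, hm⟩ := exists_pow_lt_of_lt_one (by norm_num : (0 : ℝ) < 4⁻¹) hq1
  set g : ℝ := ∫ x, x ^ (2 * m) ∂(gaussianReal 0 1)
  have hg0 : 0 ≤ g := integral_nonneg fun x => by simp only [pow_mul, Pi.zero_apply]; positivity
  refine ⟨ρ, ((2 * κ) ^ m * g).toNNReal, hρ0, hρ1, fun n _ A k j => ?_⟩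
  have hv := hR ((j + 1) / 2 ^ k) ((j + 2) / 2 ^ k) (by positivity) (by positivity)
  have habs :
      |(((j + 2) / 2 ^ k : ℝ≥0) : ℝ) - (((j + 1) / 2 ^ k : ℝ≥0) : ℝ)| ^ γ = (q ^ k) ^ 2 := by
    push_cast
    have hq2 : q ^ 2 = (2 ^ γ)⁻¹ := by
      rw [hq, ← Real.rpow_natCast, ← Real.rpow_mul (by norm_num), ← Real.rpow_neg (by norm_num)]
      congr 1
      push_cast
      ring
    rw [← sub_div, show ((j : ℝ) + 2 - (j + 1)) = 1 by ring, abs_of_nonneg (by positivity),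
      one_div, Real.inv_rpow (by positivity), ← Real.rpow_pow_comm (by norm_num), ← pow_mul,
      mul_comm k, pow_mul, hq2, inv_pow]
  rw [habs] at hv
  refine (measure_lt_levyProkhorovDist_spectralProcess_le hgauss hmean hcov A _ _ m hv
    (pow_pos hρ0 k)).trans ?_
  rw [show (4⁻¹ : ℝ≥0∞) ^ k = ENNReal.ofReal (4⁻¹ ^ k) by
      rw [ENNReal.ofReal_pow (by norm_num), ENNReal.ofReal_inv_of_pos (by norm_num)]; norm_num,
    ← ENNReal.ofReal.eq_1, ← ENNReal.ofReal_mul (by positivity)]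
  refine ENNReal.ofReal_le_ofReal ?_
  have e : κ * (q ^ k) ^ 2 / ((ρ ^ k) ^ 3 / 2) = 2 * κ * q ^ k := by
    rw [← pow_mul ρ, mul_comm k 3, pow_mul ρ, hρq]
    field_simp
  rw [e, mul_pow, ← pow_mul, mul_comm k m, pow_mul, mul_right_comm]
  gcongr

end Entries

/-! ### Measurability of path-valued maps -/

/-- The Borel σ-algebra of the compact-open topology is generated by the evaluations. -/
lemma measurable_of_measurable_eval {Ω X E : Type*} [MeasurableSpace Ω] [TopologicalSpace X]
    [SecondCountableTopology X] [LocallyCompactSpace X] [TopologicalSpace E]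
    [TopologicalSpace.PseudoMetrizableSpace E] [SecondCountableTopology E] [MeasurableSpace E]
    [BorelSpace E] [MeasurableSpace C(X, E)] [BorelSpace C(X, E)] {F : Ω → C(X, E)}
    (hF : ∀ x, Measurable fun ω => F ω x) : Measurable F := by
  let : PseudoMetricSpace E := TopologicalSpace.pseudoMetrizableSpacePseudoMetric E
  rw [BorelSpace.measurable_eq (α := C(X, E)),
    borel_eq_generateFrom_of_subbasis ContinuousMap.compactOpen_eq]
  refine measurable_generateFrom ?_
  rintro _ ⟨K, hK, U, hU, rfl⟩
  have hK : IsCompact K := hK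
  have hU : IsOpen U := hU
  obtain ⟨D, hDc, hD⟩ := TopologicalSpace.exists_countable_dense K
  -- the points of `U` at distance at least `1 / (m + 1)` from the complement of `U`
  set G : ℕ → Set E := fun m => (Metric.thickening (1 / (m + 1 : ℝ)) Uᶜ)ᶜ
  have hGc : ∀ m, IsClosed (G m) := fun m => Metric.isOpen_thickening.isClosed_compl
  have hGU : ∀ m, G m ⊆ U := fun m x hx => by
    by_contra hxU
    exact hx (Metric.self_subset_thickening (by positivity) _ hxU)
  have hset : F ⁻¹' {f : C(X, E) | Set.MapsTo f K U} =
      ⋃ m, ⋂ x ∈ D, (fun ω => F ω (x : X)) ⁻¹' G m := by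
    ext ω
    simp only [Set.mem_preimage, Set.mem_ofPred_eq, Set.mem_iUnion, Set.mem_iInter]
    constructor
    · intro h
      obtain ⟨δ, hδ, hsub⟩ := (hK.image (F ω).continuous).exists_thickening_subset_open hU
        h.image_subset
      obtain ⟨m, hm⟩ := exists_nat_one_div_lt hδ
      refine ⟨m, fun x _ hx => ?_⟩
      obtain ⟨y, hy, hxy⟩ := Metric.mem_thickening_iff.1 hx
      refine hy (hsub (Metric.mem_thickening_iff.2 ⟨_, Set.mem_image_of_mem _ x.2, ?_⟩))
      rw [dist_comm]
      exact hxy.trans hm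
    · rintro ⟨m, hm⟩ x hx
      have hcl : IsClosed {y : K | F ω y ∈ G m} :=
        (hGc m).preimage ((F ω).continuous.comp continuous_subtype_val)
      have : (⟨x, hx⟩ : K) ∈ {y : K | F ω y ∈ G m} :=
        closure_minimal (fun y hy => hm y hy) hcl (hD ⟨x, hx⟩)
      exact hGU m this
  rw [hset]
  exact MeasurableSet.iUnion fun m => MeasurableSet.biInter hDc fun x _ =>
    hF x (hGc m).measurableSet

/-- A jointly indexed family of processes with almost surely continuous paths has, up to a null
set, a measurable path map. -/
lemma exists_measurable_path {Ω : Type*} [MeasurableSpace Ω] {P : Measure Ω}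
    {X : ℕ → ℕ → ℝ≥0 → Ω → ℝ} (hX : ∀ i j t, AEMeasurable (X i j t) P)
    (hc : ∀ i j, ∀ᵐ ω ∂P, Continuous fun t => X i j t ω)
    [MeasurableSpace C(ℝ≥0, ℕ → ℕ → ℝ)] [BorelSpace C(ℝ≥0, ℕ → ℕ → ℝ)] :
    ∃ F : Ω → C(ℝ≥0, ℕ → ℕ → ℝ), Measurable F ∧
      ∀ᵐ ω ∂P, ∀ t i j, F ω t i j = X i j t ω := by
  classical
  set d : ℕ × ℕ → ℝ≥0 := fun p => (p.2 + 1) / 2 ^ p.1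
  have hae : ∀ᵐ ω ∂P, (∀ i j, Continuous fun t => X i j t ω) ∧
      ∀ i j p, X i j (d p) ω = (hX i j (d p)).mk _ ω := by
    simp only [eventually_and, ae_all_iff]
    exact ⟨hc, fun i j p => (hX i j (d p)).ae_eq_mk⟩
  -- a measurable set of full measure on which the paths are continuous, and equal to measurable
  -- modifications at the dyadic times
  obtain ⟨Ω₀, hsub, hmeas, hfull⟩ : ∃ Ω₀ : Set Ω,
      (∀ ω ∈ Ω₀, (∀ i j, Continuous fun t => X i j t ω) ∧
      ∀ i j p, X i j (d p) ω = (hX i j (d p)).mk _ ω) ∧ MeasurableSet Ω₀ ∧ ∀ᵐ ω ∂P, ω ∈ Ω₀ := by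
    obtain ⟨t, ht, htm, ht0⟩ := exists_measurable_superset_of_null hae
    exact ⟨tᶜ, fun ω hω => by_contra fun h => hω (ht h), htm.compl, compl_mem_ae_iff.2 ht0⟩
  set F : Ω → C(ℝ≥0, ℕ → ℕ → ℝ) := fun ω =>
    if h : ω ∈ Ω₀ then ⟨fun t i j => X i j t ω,
      continuous_pi fun i => continuous_pi fun j => (hsub ω h).1 i j⟩ else 0 with hF
  have hFin : ∀ ω ∈ Ω₀, ∀ t i j, F ω t i j = X i j t ω := fun ω h t i j => by simp [hF, h]
  have hdyad : ∀ p, Measurable fun ω => F ω (d p) := by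
    refine fun p => measurable_pi_lambda _ fun i => measurable_pi_lambda _ fun j => ?_
    have : (fun ω => F ω (d p) i j) = Ω₀.indicator ((hX i j (d p)).mk _) := by
      ext ω
      by_cases h : ω ∈ Ω₀
      · rw [hFin ω h, (hsub ω h).2, Set.indicator_of_mem h]
      · simp [hF, h]
    rw [this]
    exact (hX i j (d p)).measurable_mk.indicator hmeas
  refine ⟨F, measurable_of_measurable_eval fun t => ?_, ?_⟩
  · refine measurable_of_tendsto_metrizable (f := fun k ω => F ω (dyadicAbove t k))
      (fun k => hdyad (k, ⌊t * 2 ^ k⌋₊)) (tendsto_pi_nhds.2 fun ω => ?_)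
    exact ((F ω).continuous.tendsto t).comp (tendsto_dyadicAbove t)
  · filter_upwards [hfull] with ω hω using hFin ω hω

section Spectral

attribute [local instance] levyProkhorovMetricSpace

lemma continuous_empiricalSpectralMeasure_renormalizedMatrix {n : ℕ} [NeZero n]
    (A : Matrix (Fin n) (Fin n) ℝ) :
    Continuous fun x : ℕ → ℕ → ℝ =>
      empiricalSpectralMeasure (renormalizedMatrix_isHermitian x A) := by
  have hentry : ∀ i j, Continuous fun x : ℕ → ℕ → ℝ => renormalizedMatrix x A i j := by
    intro i j
    simp only [renormalizedMatrix, Matrix.of_apply]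
    split_ifs <;> fun_prop
  refine continuous_iff_continuousAt.2 fun x => Metric.tendsto_nhds.2 fun ε hε => ?_
  have hV : Continuous fun y : ℕ → ℕ → ℝ =>
      (n : ℝ)⁻¹ * ∑ i, ∑ j, (renormalizedMatrix y A i j - renormalizedMatrix x A i j) ^ 2 := by
    fun_prop
  have hlt : (n : ℝ)⁻¹ * ∑ i, ∑ j,
      (renormalizedMatrix x A i j - renormalizedMatrix x A i j) ^ 2 < (ε / 2) ^ 3 := by
    simp only [sub_self, ne_eq, OfNat.ofNat_ne_zero, not_false_eq_true, zero_pow,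
      Finset.sum_const_zero, mul_zero]
    positivity
  filter_upwards [hV.continuousAt.eventually_lt_const hlt] with y hy
  rw [dist_eq_levyProkhorovDist]
  exact (levyProkhorovDist_empiricalSpectralMeasure_le _ _ (half_pos hε).le hy.le).trans_lt
    (half_lt_self hε)

end Spectral

/-! ### Tightness at a fixed time -/

/-- Probability measures at a bounded quadratic transport cost from a tight set, in the weak form
provided by Markov's inequality, are relatively compact. -/
lemma isCompact_closure_of_thickening_bound {T : Set (ProbabilityMeasure ℝ)}
    (hT : IsTightMeasureSet {((μ : ProbabilityMeasure ℝ) : Measure ℝ) | μ ∈ T}) (c : ℝ) :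
    IsCompact (closure {ν : ProbabilityMeasure ℝ | ∃ μ ∈ T, ∀ δ : ℝ, 0 < δ → ∀ s : Set ℝ,
      MeasurableSet s → (ν : Measure ℝ).real s ≤
        (μ : Measure ℝ).real (Metric.thickening δ s) + c / δ ^ 2}) := by
  refine isCompact_closure_of_isTightMeasureSet
    (isTightMeasureSet_of_tendsto_measure_norm_gt ?_)
  rw [ENNReal.tendsto_atTop_zero]
  intro ε hε
  obtain ⟨η, hη, hηε⟩ := ENNReal.exists_nnreal_pos_mul_lt (a := 2) (by simp) hε.ne'
  have hT' := tendsto_measure_norm_gt_of_isTightMeasureSet hT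
  rw [ENNReal.tendsto_atTop_zero] at hT'
  obtain ⟨r₀, hr₀⟩ := hT' η (by exact_mod_cast hη)
  have hlim : Tendsto (fun δ : ℝ => c / δ ^ 2) atTop (𝓝 0) :=
    tendsto_const_nhds.div_atTop (tendsto_pow_atTop two_ne_zero)
  obtain ⟨δ, hδη, hδ⟩ := ((hlim.eventually_lt_const (by exact_mod_cast hη : (0 : ℝ) < η)).and
    (eventually_gt_atTop 0)).exists
  refine ⟨r₀ + δ, fun r hr => iSup₂_le ?_⟩
  rintro _ ⟨ν, ⟨μ, hμ, hνμ⟩, rfl⟩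
  have hμr : (μ : Measure ℝ) {x | r - δ < ‖x‖} ≤ η :=
    (le_iSup₂_of_le (f := fun (μ : Measure ℝ) (_ : μ ∈ {((μ : ProbabilityMeasure ℝ) : Measure ℝ) |
      μ ∈ T}) => μ {x | r - δ < ‖x‖}) _ ⟨μ, hμ, rfl⟩ le_rfl).trans (hr₀ (r - δ) (by linarith))
  have hsub : Metric.thickening δ {x : ℝ | r < ‖x‖} ⊆ {x | r - δ < ‖x‖} := by
    intro x hx
    obtain ⟨y, hy, hxy⟩ := Metric.mem_thickening_iff.1 hx
    have h1 : r < ‖y‖ := hy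
    have h2 : ‖y‖ ≤ ‖x‖ + dist x y := by
      rw [dist_comm, dist_eq_norm]
      simpa [add_comm] using norm_le_norm_add_norm_sub' y x
    change r - δ < ‖x‖
    linarith
  have hmeas : MeasurableSet {x : ℝ | r < ‖x‖} :=
    measurableSet_lt measurable_const measurable_norm
  have h1 := hνμ δ hδ _ hmeas
  have h2 : (μ : Measure ℝ).real (Metric.thickening δ {x : ℝ | r < ‖x‖}) ≤ η :=
    ENNReal.toReal_le_of_le_ofReal η.2 (by
      rw [ENNReal.ofReal_coe_nnreal]
      exact (measure_mono hsub).trans hμr)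
  refine le_trans ?_ hηε.le
  rw [← ofReal_measureReal (measure_ne_top _ _)]
  calc ENNReal.ofReal ((ν : Measure ℝ).real {x : ℝ | r < ‖x‖}) ≤ ENNReal.ofReal (η + η) :=
        ENNReal.ofReal_le_ofReal (by linarith)
    _ = η * 2 := by
        rw [ENNReal.ofReal_add η.coe_nonneg η.coe_nonneg, ENNReal.ofReal_coe_nnreal, mul_two]
    _ = _ := rfl

lemma isTightMeasureSet_of_tendsto {u : ℕ+ → ProbabilityMeasure ℝ} {μ₀ : ProbabilityMeasure ℝ}
    (hu : Tendsto u atTop (𝓝 μ₀)) :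
    IsTightMeasureSet {((μ : ProbabilityMeasure ℝ) : Measure ℝ) | μ ∈ Set.range u} := by
  refine isTightMeasureSet_of_isCompact_closure ?_
  have hlim : Tendsto (fun k : ℕ => u k.succPNat) atTop (𝓝 μ₀) := by
    refine hu.comp (tendsto_atTop.2 fun b => ?_)
    filter_upwards [eventually_ge_atTop (b : ℕ)] with k hk
    rw [← PNat.coe_le_coe, Nat.succPNat_coe]
    omega
  refine hlim.isCompact_insert_range.closure_of_subset ?_
  rintro _ ⟨n, rfl⟩
  exact Set.mem_insert_of_mem _ ⟨n.natPred, by simp⟩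

/-- The laws of the empirical spectral measures at a fixed time are tight. -/
lemma exists_isCompact_spectralProcess {Ω : Type*} [MeasurableSpace Ω] {P : Measure Ω}
    {X : ℕ → ℕ → ℝ≥0 → Ω → ℝ} (hgauss : ∀ i j, IsGaussianProcess (X i j) P)
    (hmean : ∀ i j t, ∫ ω, X i j t ω ∂P = 0) {t : ℝ≥0} {v : ℝ}
    (hv : ∀ i j, ∫ ω, X i j t ω ^ 2 ∂P ≤ v)
    {A : (n : ℕ+) → Matrix (Fin n) (Fin n) ℝ} (hA : ∀ n, (A n).IsHermitian)
    (hT : IsTightMeasureSet {((μ : ProbabilityMeasure ℝ) : Measure ℝ) |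
      μ ∈ Set.range fun n : ℕ+ => empiricalSpectralMeasure (hA n)}) {ε : ℝ≥0∞} (hε : 0 < ε) :
    ∃ Q : Set (ProbabilityMeasure ℝ), IsCompact Q ∧
      ∀ n : ℕ+, P {ω | spectralProcess X (A n) t ω ∉ Q} ≤ ε := by
  have hlim : Tendsto (fun a : ℝ => ENNReal.ofReal
      ((v / a) ^ 1 * ∫ x, x ^ (2 * 1) ∂(gaussianReal 0 1))) atTop (𝓝 0) := by
    have : Tendsto (fun a : ℝ => (v / a) ^ 1 * ∫ x, x ^ (2 * 1) ∂(gaussianReal 0 1))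
        atTop (𝓝 0) := by
      simpa using
        (tendsto_const_nhds.div_atTop tendsto_id : Tendsto (fun a : ℝ => v / a) _ _).mul_const
          (∫ x, x ^ (2 * 1) ∂(gaussianReal 0 1))
    simpa using ENNReal.tendsto_ofReal this
  obtain ⟨a, haε, ha⟩ := ((hlim.eventually_le_const hε).and (eventually_gt_atTop 0)).exists
  refine ⟨_, isCompact_closure_of_thickening_bound hT (2 * a), fun n => ?_⟩
  refine le_trans (measure_mono fun ω hω => ?_)
    ((measure_lt_mean_sq_le_of_hasGaussianLaw
      (Z := fun (p : Fin n × Fin n) ω => X (min p.1 p.2 : Fin n) (max p.1 p.2 : Fin n) t ω)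
      (fun p => (hgauss _ _).hasGaussianLaw_eval t) (fun p => hmean _ _ t)
      (fun p => hv _ _) 1 ha).trans haε)
  by_contra hcon
  refine hω (subset_closure ⟨_, ⟨n, rfl⟩, fun δ hδ s hs => ?_⟩)
  refine (empiricalSpectralMeasure_real_le _ (hA n) hs hδ).trans ?_
  refine add_le_add le_rfl (div_le_div_of_nonneg_right ?_ (by positivity))
  have h := normalized_sum_sub_sq_le (fun i j => X i j t ω) (fun _ _ => 0) (A n)
  rw [renormalizedMatrix_zero (hA n)] at h
  simp only [sub_zero] at h
  have hcon' := not_lt.1 (show ¬ a < _ from hcon)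
  linarith

end SpectralTightness

theorem proposition4p1 {Ω : Type*} [MeasurableSpace Ω] (P : Measure Ω) [IsProbabilityMeasure P]
    -- independent centered Gaussian processes with common covariance function `R`
    (X : ℕ → ℕ → ℝ≥0 → Ω → ℝ) (R : ℝ≥0 → ℝ≥0 → ℝ)
    (hgauss : ∀ i j, IsGaussianProcess (X i j) P)
    (hindep : iIndepFun (fun (p : ℕ × ℕ) (ω : Ω) (t : ℝ≥0) => X p.1 p.2 t ω) P)
    (hmean : ∀ i j t, ∫ ω, X i j t ω ∂P = 0)
    (hcov : ∀ i j s t, ∫ ω, X i j s ω * X i j t ω ∂P = R s t)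
    (hR : SpectralTightness.IncrementCondition R)
    -- deterministic symmetric matrices whose empirical spectral measures converge weakly
    (A : (n : ℕ+) → Matrix (Fin n) (Fin n) ℝ) (hA : ∀ n, (A n).IsHermitian)
    (μ₀ : ProbabilityMeasure ℝ)
    (hA₀ : Tendsto (fun n : ℕ+ => SpectralTightness.empiricalSpectralMeasure (hA n))
      atTop (𝓝 μ₀)) :
    -- if the Gaussian processes have continuous paths, the spectral measure processes are random
    -- elements of the path space
    ((∀ i j, ∀ᵐ ω ∂P, Continuous fun t => X i j t ω) →
      ∃ M : ℕ+ → Ω → C(ℝ≥0, ProbabilityMeasure ℝ), (∀ n, Measurable (M n)) ∧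
        ∀ n, ∀ᵐ ω ∂P, ∀ t, M n ω t = SpectralTightness.spectralProcess X (A n) t ω) ∧
    -- the laws of (any continuous versions of) the spectral measure processes are tight
    (∀ M : ℕ+ → Ω → C(ℝ≥0, ProbabilityMeasure ℝ), (∀ n, Measurable (M n)) →
      (∀ n t, ∀ᵐ ω ∂P, M n ω t = SpectralTightness.spectralProcess X (A n) t ω) →
      IsTightMeasureSet (Set.range fun n => P.map (M n))) := by
  constructor
  · intro hc
    let : MeasurableSpace C(ℝ≥0, ℕ → ℕ → ℝ) := borel _
    have : BorelSpace C(ℝ≥0, ℕ → ℕ → ℝ) := ⟨rfl⟩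
    obtain ⟨F, hF, hFX⟩ := SpectralTightness.exists_measurable_path
      (fun i j t => (hgauss i j).aemeasurable t) hc
    set Φ : (n : ℕ+) → C(ℕ → ℕ → ℝ, ProbabilityMeasure ℝ) := fun n =>
      ⟨_, SpectralTightness.continuous_empiricalSpectralMeasure_renormalizedMatrix (A n)⟩
    refine ⟨fun n ω => (Φ n).comp (F ω),
      fun n => (ContinuousMap.continuous_postcomp (Φ n)).measurable.comp hF, fun n => ?_⟩
    filter_upwards [hFX] with ω hω t
    have : F ω t = fun i j => X i j t ω := funext fun i => funext fun j => hω t i j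
    change SpectralTightness.empiricalSpectralMeasure
      (SpectralTightness.renormalizedMatrix_isHermitian (F ω t) (A n)) = _
    rw [this]
    rfl
  · intro M hM hMX
    let := SpectralTightness.levyProkhorovMetricSpace ℝ
    have : CompleteSpace (ProbabilityMeasure ℝ) :=
      SpectralTightness.completeSpace_probabilityMeasure
    obtain ⟨ρ, c, hρ, hρ1, hstep⟩ :=
      SpectralTightness.exists_dyadic_increment_bound hgauss hmean hcov hR
    refine SpectralTightness.isTightMeasureSet_of_dyadic hM hρ.le hρ1 (c := c)
      (fun n k j => ?_) fun t _ ε hε => ?_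
    · refine (measure_mono_ae ?_).trans (hstep n (A n) k j)
      filter_upwards [hMX n ((j + 1) / 2 ^ k), hMX n ((j + 2) / 2 ^ k)] with ω h1 h2 hω
      have hω' : ρ ^ k < dist (M n ω ((j + 1) / 2 ^ k)) (M n ω ((j + 2) / 2 ^ k)) := hω
      rw [h1, h2] at hω'
      exact hω'
    · obtain ⟨Q, hQ, hQP⟩ := SpectralTightness.exists_isCompact_spectralProcess hgauss hmean
        (t := t) (v := R t t) (fun i j => by simp only [sq]; exact (hcov i j t t).le) hA
        (SpectralTightness.isTightMeasureSet_of_tendsto hA₀) hε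
      refine ⟨Q, hQ, fun n => (measure_mono_ae ?_).trans (hQP n)⟩
      filter_upwards [hMX n t] with ω h1 hω
      have hω' : M n ω t ∉ Q := hω
      rw [h1] at hω'
      exact hω'
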